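/- There is a universal constant $d>0$ such that the following holds. Let $n\ge 2$, $p\ge 1$, $s\ge 0$, $K\ge 0$ be integers with $$K \;\ge\; \frac{144\,p^6\,9^p\,s^2\log n}{n}.$$ Let $\dot u=f(u)$ be an evolution equation in $\mathbb{R}^n$ whose components satisfy the cyclic condition $f_j(u_1,\dots,u_n)=f_i(u_{j-i+1},u_{j-i+2},\dots,u_{j-i+n})$ for all $i,j$ (indices modulo $n$), and suppose $f_1=\sum_{|\alpha|\le p}c_\alpha L_\alpha$ where $L_\alpha(x)=\prod_{i=1}^n\sqrt{2\alpha_i+1}\,P_{\alpha_i}(x_i)$ are the tensorized orthonormal Legendre polynomials ($P_k$ is the Legendre polynomial of degree $k$) and the coefficient vector $c$ has at most $s$ non-zero entries. Let $u(\cdot\,;k)$, $1\le k\le K$, be trajectories on $[t_0,t_1]$, $t_0<t_1$, that almost surely solve $\dot u=f(u)$ and whose initial data $u(t_0;k)$ are independent and uniformly distributed in $[-1,1]^n$. Let $A_L$ be the $nK\times\binom{n+p}{p}$ cyclic Legendre sampling matrix, whose row $(k,i)$ consists of the values of all $L_\alpha$, $|\alpha|\le p$, at the cyclically shifted vector $(u_i,u_{i+1},\dots,u_n,u_1,\dots,u_{i-1})(t_0;k)$.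 Then there is an event of probability exceeding $$1-\Big(\frac{e}{p}+\frac{e}{2p^2}\Big)^{2p}n^{-2p/11}$$ on which the following holds for all approximate velocities $\widetilde{\dot u}(t_0;k)\in\mathbb{R}^n$ and all $\eta$ with $$\sqrt{\frac1K\sum_{k=1}^K\big|\widetilde{\dot u}(t_0;k)-\dot u(t_0;k)\big|^2}\le\eta .$$ Put $\sigma=\sqrt K\,\eta$, let $V\in\mathbb{R}^{nK}$ be the vector of all components of the $\widetilde{\dot u}(t_0;k)$, and let $c^\#$ be any minimizer of $$\min_{c'}\|c'\|_1\quad\text{subject to}\quad\|A_Lc'-V\|_2\le\sigma .$$ Then $\|c-c^\#\|_1\le d\,s\,\sigma$. Moreover, with the same constant $d$, if $S=\operatorname{supp}(c)$ and $$\sigma<\frac{\min_{j\in S}|c_j|}{2\,d\,s},$$ then every set $S^\#$ of indices of the $|S|$ largest entries of $c^\#$ in magnitude (ties broken arbitrarily) is equal to $S$; in particular, if $c$ has exactly $s$ non-zero entries, the set of indices of the $s$ largest entries of $c^\#$ is the support of $c$. (If $S=\emptyset$, the condition on $\sigma$ is void.) -/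

import Mathlib

namespace CyclicRecovery

/-- The classical Legendre polynomial `P_k`, by Rodrigues' formula
`P_k = (2 ^ k * k !)⁻¹ * (d/dx)^k (x ^ 2 - 1) ^ k`. -/
noncomputable def legendre (k : ℕ) : Polynomial ℝ :=
  Polynomial.C (1 / ((2 : ℝ) ^ k * (k.factorial : ℝ))) *
    (Polynomial.derivative^[k] ((Polynomial.X ^ 2 - 1) ^ k))

/-- Multi-indices `α ∈ ℕ ^ n` with `|α| ≤ p`; they index the `(n + p).choose p` tensorized
Legendre polynomials of degree at most `p` in `n` variables. -/
abbrev MultiIndex (n p : ℕ) : Type :=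
  {α : Fin n → Fin (p + 1) // ∑ i, (α i : ℕ) ≤ p}

/-- The tensorized Legendre polynomial `x ↦ ∏ i, √(2 α_i + 1) P_{α_i}(x_i)`, orthonormal with
respect to the uniform probability measure on `[-1, 1] ^ n`. -/
noncomputable def tensorLegendre {n p : ℕ} (α : MultiIndex n p) (x : Fin n → ℝ) : ℝ :=
  ∏ i, Real.sqrt (2 * ((α.1 i : ℕ) : ℝ) + 1) * (legendre (α.1 i : ℕ)).eval (x i)

/-- Cyclic shift of a state vector: `(x_{a}, x_{a + 1}, …)`, indices modulo `n`. -/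
def cyclicShift {n : ℕ} (a : Fin n) (x : Fin n → ℝ) : Fin n → ℝ :=
  fun l => x (l + a)

/-- The cyclic structural condition on the components of a vector field:
`f_j(x) = f_i(x_{j - i + 1}, x_{j - i + 2}, …)` for all `i`, `j`, indices modulo `n`. -/
def IsCyclic {n : ℕ} (f : (Fin n → ℝ) → (Fin n → ℝ)) : Prop :=
  ∀ (i j : Fin n) (x : Fin n → ℝ), f x j = f (cyclicShift (j - i) x) i

/-- `c` is the coefficient vector of the first component of `f` in the tensorized Legendre basis
of order `p` (so that this component is a polynomial of degree at most `p`). -/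
def IsLegendreCoeff {n p : ℕ} [NeZero n] (f : (Fin n → ℝ) → (Fin n → ℝ))
    (c : MultiIndex n p → ℝ) : Prop :=
  ∀ x : Fin n → ℝ, f x 0 = ∑ α, c α * tensorLegendre α x

/-- `x` solves the evolution equation `ẋ = f(x)` on the time interval `[t₀, t₁]`. -/
def IsTrajectory {n : ℕ} (f : (Fin n → ℝ) → (Fin n → ℝ)) (t₀ t₁ : ℝ)
    (x : ℝ → (Fin n → ℝ)) : Prop :=
  ∀ t ∈ Set.Icc t₀ t₁, HasDerivWithinAt x (f (x t)) (Set.Icc t₀ t₁) t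

/-- The cyclic Legendre sampling matrix of order `p` generated by `K` vectors: the row `(k, i)`
holds the values of all basis functions at the `i`-th cyclic shift of `y k`. -/
noncomputable def dictionary {n K : ℕ} (p : ℕ) (y : Fin K → Fin n → ℝ) :
    Matrix (Fin K × Fin n) (MultiIndex n p) ℝ :=
  Matrix.of fun r α => tensorLegendre α (cyclicShift r.2 (y r.1))

/-- The `ℓ¹` norm. -/
def l1Norm {ι : Type*} [Fintype ι] (x : ι → ℝ) : ℝ := ∑ i, |x i|

/-- The `ℓ²` norm. -/
noncomputable def l2Norm {ι : Type*} [Fintype ι] (x : ι → ℝ) : ℝ := Real.sqrt (∑ i, x i ^ 2)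

/-- `z` is a solution of: minimize `‖c'‖₁` subject to `‖A c' - V‖₂ ≤ σ`. -/
def IsBPMinimizer {ι κ : Type*} [Fintype ι] [Fintype κ] (A : Matrix ι κ ℝ) (V : ι → ℝ) (σ : ℝ)
    (z : κ → ℝ) : Prop :=
  l2Norm (A.mulVec z - V) ≤ σ ∧ ∀ c' : κ → ℝ, l2Norm (A.mulVec c' - V) ≤ σ → l1Norm z ≤ l1Norm c'

/-- The support of a coefficient vector. -/
noncomputable def supp {κ : Type*} [Fintype κ] (c : κ → ℝ) : Finset κ :=
  {j : κ | c j ≠ 0}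

/-- `T` is a set of indices of the `r` largest entries in magnitude of `z` (ties are broken
arbitrarily). -/
def IsLargestSet {κ : Type*} (z : κ → ℝ) (r : ℕ) (T : Finset κ) : Prop :=
  T.card = r ∧ ∀ i ∈ T, ∀ j ∉ T, |z j| ≤ |z i|

end CyclicRecovery

/-! Cyclicity turns each sample into `n` equations for the single vector `c`: the row `(k, i)` of
the dictionary applied to `c` gives `f_i` at sample `k` (`mulVec_dictionary`). Hence `c` is feasible
for the basis pursuit problem, and it suffices that the columns be incoherent: the Gram matrix `AᵀA`
should be entrywise within `nK · 2/(5s)` of `nK` times the identity. `l1Norm_sub_le_of_gram` then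
gives the error bound deterministically, by pairing the error with its restriction to the support.

A Gram entry is a sum over independent samples of `shiftCorrelation`, whose mean is `n` or `0` by
orthonormality. The `n` shifts of one sample are dependent, but a basis function depends on at most
`p` coordinates. Changing one coordinate therefore affects at most `2p` shifts, each by at most `2 ·
3^p`, because `|P_k| ≤ 1` on `[-1, 1]`. The coordinates of a uniform sample are independent, so
McDiarmid's inequality makes each sample's correlation sub-Gaussian with parameter `n (2p 3^p)²`,
and these parameters add over the `K` samples.

A union bound over at most `(n+1)^(2p)` entries finishes: the lower bound on `K` makes each tail at
most `2 exp(-(72/25) p⁴ log n)`. The support follows from the `ℓ¹` error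
(`eq_supp_of_isLargestSet`). -/

namespace CyclicRecovery

/-! ### Legendre polynomials: differential equation, sup bound, orthogonality. -/

section Legendre

open Polynomial

lemma iterate_derivative_X_mul' (m : ℕ) (g : ℝ[X]) :
    derivative^[m + 1] (X * g) =
      X * derivative^[m + 1] g + ((m : ℝ[X]) + 1) * derivative^[m] g := by
  induction m with
  | zero => simp [derivative_mul, add_comm]
  | succ m ih =>
    rw [Function.iterate_succ_apply', ih]
    simp only [derivative_add, derivative_mul, derivative_X, derivative_natCast, derivative_one,
      ← Function.iterate_succ_apply' (f := derivative)]
    push_cast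
    ring

lemma iterate_derivative_X_sq_sub_one_mul (m : ℕ) (g : ℝ[X]) :
    derivative^[m + 2] ((X ^ 2 - 1) * g) = (X ^ 2 - 1) * derivative^[m + 2] g +
      2 * ((m : ℝ[X]) + 2) * X * derivative^[m + 1] g +
      ((m : ℝ[X]) + 2) * ((m : ℝ[X]) + 1) * derivative^[m] g := by
  have h : (X ^ 2 - 1) * g = X * (X * g) - g := by ring
  rw [h, iterate_derivative_sub, iterate_derivative_X_mul' (m + 1), iterate_derivative_X_mul' (m + 1),
    iterate_derivative_X_mul' m]
  push_cast
  ring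

lemma natDegree_legendre_le (k : ℕ) : (legendre k).natDegree ≤ k := by
  refine (natDegree_C_mul_le _ _).trans ((natDegree_iterate_derivative _ _).trans ?_)
  have h : ((X ^ 2 - 1 : ℝ[X]) ^ k).natDegree ≤ k * 2 := by
    refine natDegree_pow_le_of_le k ?_
    compute_degree
  omega

/-- The Legendre differential equation. -/
lemma legendre_ode (k : ℕ) :
    (X ^ 2 - 1) * derivative (derivative (legendre k)) + 2 * X * derivative (legendre k) =
      (k : ℝ[X]) * ((k : ℝ[X]) + 1) * legendre k := by
  obtain _ | m := k
  · simp [legendre]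
  set u : ℝ[X] := (X ^ 2 - 1) ^ (m + 1) with hu
  -- Differentiating this first-order equation `m + 2` times by Leibniz gives the Legendre equation
  -- for the `(m + 1)`-st derivative of `u`.
  have h1 : (X ^ 2 - 1) * derivative u = 2 * ((m : ℝ[X]) + 1) * (X * u) := by
    rw [hu, derivative_pow]
    simp only [derivative_sub, derivative_X_pow, derivative_one]
    push_cast
    simp only [map_add, map_natCast, map_one, C_ofNat, pow_one]
    ring
  have h2 := congrArg (derivative^[m + 2]) h1
  have h3 : (2 * ((m : ℝ[X]) + 1) * (X * u)) = C (2 * ((m : ℝ) + 1)) * (X * u) := by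
    simp only [map_mul, C_ofNat, map_add, map_natCast, map_one]
  rw [iterate_derivative_X_sq_sub_one_mul, h3, iterate_derivative_C_mul,
    iterate_derivative_X_mul' (m + 1)] at h2
  simp only [← Function.iterate_succ_apply] at h2
  have hD : legendre (m + 1) =
    C (1 / ((2 : ℝ) ^ (m + 1) * ((m + 1).factorial : ℝ))) * derivative^[m + 1] u := rfl
  rw [hD]
  simp only [derivative_C_mul, ← Function.iterate_succ_apply' (f := derivative)]
  simp only [map_mul, C_ofNat, map_add, map_natCast, map_one, Nat.succ_eq_add_one] at h2
  push_cast at h2 ⊢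
  linear_combination C (1 / ((2 : ℝ) ^ (m + 1) * ((m + 1).factorial : ℝ))) * h2

lemma eval_iterate_derivative_eq_factorial_mul_coeff (k : ℕ) (r : ℝ) (q : ℝ[X]) :
    (derivative^[k] q).eval r = k.factorial * (taylor r q).coeff k := by
  rw [taylor_coeff, ← factorial_smul_hasseDeriv]
  simp

/-- At `r = ±1` the polynomial `X² - 1` recentres to `(X + 2r) X`, so the `k`-th coefficient is the
constant term of `(X + 2r)^k`. This supplies `P_k(±1)² = 1`. -/
lemma coeff_taylor_X_sq_sub_one_pow (k : ℕ) {r : ℝ} (hr : r ^ 2 = 1) :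
    (taylor r ((X ^ 2 - 1) ^ k)).coeff k = (2 * r) ^ k := by
  have : taylor r ((X ^ 2 - 1) ^ k) = (X + C (2 * r)) ^ k * X ^ k := by
    rw [taylor_pow, map_sub, taylor_pow, taylor_X, taylor_one, ← mul_pow, ← hr]
    congr 1
    simp only [map_mul, C_ofNat, map_pow]
    ring
  rw [this]
  have := coeff_mul_X_pow ((X + C (2 * r)) ^ k) k 0
  rw [zero_add] at this
  rw [this, coeff_zero_eq_eval_zero]
  simp

lemma sq_eval_legendre (k : ℕ) {r : ℝ} (hr : r ^ 2 = 1) : ((legendre k).eval r) ^ 2 = 1 := by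
  rw [legendre, eval_mul, eval_C, eval_iterate_derivative_eq_factorial_mul_coeff,
    coeff_taylor_X_sq_sub_one_pow k hr]
  have : (k.factorial : ℝ) ≠ 0 := by positivity
  have h2 : (r ^ k) ^ 2 = 1 := by rw [← pow_mul, mul_comm, pow_mul, hr, one_pow]
  rw [mul_pow]
  rw [mul_pow 2 r, mul_pow (k.factorial : ℝ), mul_pow (2 ^ k), h2]
  field_simp

/-- Sonin's argument: by the differential equation, `q = k(k+1) P² + (1 - X²) P'²` has derivative
`2X P'²`, so on `[-1, 1]` it is largest at the endpoints, where it equals `k(k+1)`. -/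
lemma abs_eval_legendre_le_one (k : ℕ) {x : ℝ} (hx : x ∈ Set.Icc (-1 : ℝ) 1) :
    |(legendre k).eval x| ≤ 1 := by
  obtain rfl | hk := Nat.eq_zero_or_pos k
  · simp [legendre]
  set P := legendre k
  set q : ℝ[X] := (k : ℝ[X]) * ((k : ℝ[X]) + 1) * P ^ 2 + (1 - X ^ 2) * (derivative P) ^ 2 with hq
  have hq' : derivative q = 2 * X * (derivative P) ^ 2 := by
    have h := legendre_ode k
    have : derivative q = 2 * ((k : ℝ[X]) * ((k : ℝ[X]) + 1)) * P * derivative P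
        - 2 * X * (derivative P) ^ 2
        + 2 * (1 - X ^ 2) * derivative P * derivative (derivative P) := by
      simp only [hq, derivative_add, derivative_mul, derivative_natCast, derivative_one,
        derivative_sub, derivative_X, derivative_pow]
      push_cast
      simp only [C_ofNat]
      ring
    rw [this]
    linear_combination (-2 * derivative P) * h
  have hderiv : ∀ y, deriv (fun z => q.eval z) y = 2 * y * ((derivative P).eval y) ^ 2 := by
    intro y
    rw [Polynomial.deriv, hq']
    simp
  have hkpos : (0 : ℝ) < k * (k + 1) := by positivity
  have hend : ∀ r : ℝ, r ^ 2 = 1 → q.eval r = k * (k + 1) := by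
    intro r hr
    simp [hq, hr, sq_eval_legendre k hr, P]
  have hle : q.eval x ≤ k * (k + 1) := by
    rcases le_total 0 x with h0 | h0
    · have hmono : MonotoneOn (fun z => q.eval z) (Set.Icc 0 1) := by
        refine monotoneOn_of_deriv_nonneg (convex_Icc 0 1) q.continuous.continuousOn
          q.differentiable.differentiableOn fun y hy => ?_
        rw [interior_Icc] at hy
        rw [hderiv]
        have := hy.1
        positivity
      have := hmono ⟨h0, hx.2⟩ (Set.right_mem_Icc.2 zero_le_one) hx.2
      simpa [hend 1 (by norm_num)] using this
    · have hanti : AntitoneOn (fun z => q.eval z) (Set.Icc (-1) 0) := by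
        refine antitoneOn_of_deriv_nonpos (convex_Icc (-1) 0) q.continuous.continuousOn
          q.differentiable.differentiableOn fun y hy => ?_
        rw [interior_Icc] at hy
        rw [hderiv]
        have := hy.2
        exact mul_nonpos_of_nonpos_of_nonneg (by linarith) (sq_nonneg _)
      have := hanti (Set.left_mem_Icc.2 (by norm_num)) ⟨hx.1, h0⟩ hx.1
      simpa [hend (-1) (by norm_num)] using this
  have hqx : q.eval x = k * (k + 1) * (P.eval x) ^ 2
      + (1 - x ^ 2) * ((derivative P).eval x) ^ 2 := by simp [hq]
  have hx2 : 0 ≤ 1 - x ^ 2 := by nlinarith [hx.1, hx.2]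
  have h3 : k * (k + 1) * (P.eval x) ^ 2 ≤ (k * (k + 1) : ℝ) * 1 := by
    have := mul_nonneg hx2 (sq_nonneg ((derivative P).eval x))
    linarith
  exact abs_le_one_iff_mul_self_le_one.2 (by
    have := le_of_mul_le_mul_left h3 hkpos
    nlinarith)

lemma integral_eval_derivative (q : ℝ[X]) (a b : ℝ) :
    ∫ x in a..b, (derivative q).eval x = q.eval b - q.eval a :=
  intervalIntegral.integral_eq_sub_of_hasDerivAt (fun x _ => q.hasDerivAt x)
    ((derivative q).continuous.intervalIntegrable _ _)

lemma eval_iterate_derivative_eq_zero {j k : ℕ} (hj : j < k) {r : ℝ} (hr : r ^ 2 = 1) :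
    (derivative^[j] ((X ^ 2 - 1 : ℝ[X]) ^ k)).eval r = 0 := by
  have h := pow_sub_dvd_iterate_derivative_pow (X ^ 2 - 1 : ℝ[X]) k j
  have h2 : (X ^ 2 - 1 : ℝ[X]) ∣ derivative^[j] ((X ^ 2 - 1 : ℝ[X]) ^ k) :=
    (dvd_pow_self _ (by omega)).trans h
  obtain ⟨w, hw⟩ := h2
  rw [hw]
  simp [hr]

/-- Repeated integration by parts; the boundary terms vanish because `X² - 1` divides every
derivative of order below `k`. -/
lemma integral_iterate_derivative_mul {j k : ℕ} (hj : j ≤ k) (q : ℝ[X]) :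
    ∫ x in (-1 : ℝ)..1, (derivative^[j] ((X ^ 2 - 1 : ℝ[X]) ^ k) * q).eval x =
      (-1) ^ j * ∫ x in (-1 : ℝ)..1, ((X ^ 2 - 1 : ℝ[X]) ^ k * derivative^[j] q).eval x := by
  induction j generalizing q with
  | zero => simp
  | succ j ih =>
    have h1 := integral_eval_derivative (derivative^[j] ((X ^ 2 - 1 : ℝ[X]) ^ k) * q) (-1) 1
    rw [eval_mul, eval_mul, eval_iterate_derivative_eq_zero (by omega) (by norm_num),
      eval_iterate_derivative_eq_zero (by omega) (by norm_num), derivative_mul] at h1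
    simp only [eval_add (R := ℝ)] at h1
    rw [intervalIntegral.integral_add ((Polynomial.continuous _).intervalIntegrable _ _)
      ((Polynomial.continuous _).intervalIntegrable _ _), ih (by omega)] at h1
    rw [Function.iterate_succ_apply', Function.iterate_succ_apply, pow_succ (-1 : ℝ) j]
    linarith

lemma integral_legendre_mul_eq_zero {k : ℕ} {q : ℝ[X]} (hq : derivative^[k] q = 0) :
    ∫ x in (-1 : ℝ)..1, (legendre k * q).eval x = 0 := by
  have h := integral_iterate_derivative_mul (le_refl k) q
  rw [hq] at h
  simp only [mul_zero, eval_zero, intervalIntegral.integral_zero] at h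
  simp only [legendre, mul_assoc, eval_C_mul]
  rw [intervalIntegral.integral_const_mul, h, mul_zero]

lemma integral_legendre_mul_legendre_of_ne {j k : ℕ} (h : j ≠ k) :
    ∫ x in (-1 : ℝ)..1, (legendre j * legendre k).eval x = 0 := by
  wlog hjk : j < k generalizing j k
  · rw [mul_comm]
    exact this h.symm (by omega)
  rw [mul_comm]
  exact integral_legendre_mul_eq_zero
    (iterate_derivative_eq_zero ((natDegree_legendre_le j).trans_lt hjk))

/-- `X P' - k P` loses its degree-`k` term, hence is orthogonal to `P`. Integrating `(X P²)' = 2 P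
(X P' - k P) + (2k + 1) P²` then leaves only the endpoint values. -/
lemma integral_legendre_sq (k : ℕ) :
    ∫ x in (-1 : ℝ)..1, (legendre k * legendre k).eval x = 2 / (2 * k + 1) := by
  set P := legendre k with hP
  have hzero : derivative^[k] (X * derivative P - (k : ℝ[X]) * P) = 0 := by
    obtain _ | m := k
    · simp [hP, legendre]
    · have h0 : derivative^[m + 1 + 1] P = 0 :=
        iterate_derivative_eq_zero ((natDegree_legendre_le _).trans_lt (by omega))
      rw [iterate_derivative_sub, iterate_derivative_X_mul', iterate_derivative_natCast_mul,
        ← Function.iterate_succ_apply, ← Function.iterate_succ_apply, h0]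
      push_cast
      ring
  have h1 := integral_legendre_mul_eq_zero hzero
  have h2 := integral_eval_derivative (X * (P * P)) (-1) 1
  have e : derivative (X * (P * P)) = 2 * (P * (X * derivative P - (k : ℝ[X]) * P))
      + (2 * (k : ℝ[X]) + 1) * (P * P) := by
    simp only [derivative_mul, derivative_X]; ring
  rw [e] at h2
  have e2 : ∀ x, (2 * (P * (X * derivative P - (k : ℝ[X]) * P))
      + (2 * (k : ℝ[X]) + 1) * (P * P)).eval x =
      2 * (P * (X * derivative P - (k : ℝ[X]) * P)).eval x
        + (2 * k + 1) * (P * P).eval x := by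
    intro x
    simp
  simp only [e2] at h2
  rw [intervalIntegral.integral_add (by exact Continuous.intervalIntegrable (by fun_prop) _ _)
    (by exact Continuous.intervalIntegrable (by fun_prop) _ _),
    intervalIntegral.integral_const_mul, intervalIntegral.integral_const_mul, h1] at h2
  have h3 : eval 1 (X * (P * P)) = 1 := by
    have := sq_eval_legendre k (r := 1) (by norm_num)
    simpa [← pow_two] using this
  have h4 : eval (-1) (X * (P * P)) = -1 := by
    have := sq_eval_legendre k (r := -1) (by norm_num)
    simpa [← pow_two] using this
  rw [h3, h4] at h2
  rw [eq_div_iff (by positivity)]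
  linarith

lemma integral_legendre_mul_legendre (j k : ℕ) :
    ∫ x in (-1 : ℝ)..1, (Real.sqrt (2 * j + 1) * (legendre j).eval x) *
      (Real.sqrt (2 * k + 1) * (legendre k).eval x) = if j = k then 2 else 0 := by
  have e : ∀ x : ℝ, (Real.sqrt (2 * j + 1) * (legendre j).eval x) *
      (Real.sqrt (2 * k + 1) * (legendre k).eval x) =
      (Real.sqrt (2 * j + 1) * Real.sqrt (2 * k + 1)) * (legendre j * legendre k).eval x := by
    intro x; rw [eval_mul]; ring
  simp only [e]
  rw [intervalIntegral.integral_const_mul]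
  split_ifs with h
  · subst h
    rw [integral_legendre_sq, Real.mul_self_sqrt (by positivity)]
    field_simp
  · rw [integral_legendre_mul_legendre_of_ne h, mul_zero]

end Legendre

/-! ### McDiarmid's inequality in sub-Gaussian form. -/

section BoundedDifferences

open MeasureTheory ProbabilityTheory
open scoped NNReal

/-- Hoeffding's lemma for a bounded function of oscillation at most `c`. -/
lemma hasSubgaussianMGF_of_osc_le {X : Type*} [MeasurableSpace X] (ν : Measure X)
    [IsProbabilityMeasure ν] {g : X → ℝ} (hg : Measurable g) {c : ℝ≥0}
    (hc : ∀ x y, |g y - g x| ≤ c) :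
    HasSubgaussianMGF (fun x => g x - ∫ y, g y ∂ν) ((c / 2) ^ 2) ν := by
  obtain ⟨x₀⟩ : Nonempty X := nonempty_of_isProbabilityMeasure ν
  have hbdd : BddBelow (Set.range g) := ⟨g x₀ - c, by
    rintro _ ⟨y, rfl⟩
    have := abs_le.1 (hc x₀ y)
    linarith⟩
  have hne : (Set.range g).Nonempty := ⟨_, x₀, rfl⟩
  have hmem : ∀ x, g x ∈ Set.Icc (sInf (Set.range g)) (sInf (Set.range g) + c) := by
    refine fun x => ⟨csInf_le hbdd ⟨x, rfl⟩, ?_⟩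
    have : g x - c ≤ sInf (Set.range g) := by
      refine le_csInf hne ?_
      rintro _ ⟨y, rfl⟩
      have := abs_le.1 (hc x y)
      linarith
    linarith
  have := hasSubgaussianMGF_of_mem_Icc (μ := ν) hg.aemeasurable (ae_of_all _ hmem)
  simpa using this

lemma integrable_of_forall_abs_le {X : Type*} [MeasurableSpace X] {μ : Measure X}
    [IsFiniteMeasure μ] {g : X → ℝ} (hg : Measurable g) {B : ℝ} (hB : ∀ x, |g x| ≤ B) :
    Integrable g μ :=
  Integrable.of_bound hg.aestronglyMeasurable B (ae_of_all _ hB)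

lemma integrable_exp_of_forall_abs_le {X : Type*} [MeasurableSpace X] {μ : Measure X}
    [IsFiniteMeasure μ] {g : X → ℝ} (hg : Measurable g) {B : ℝ} (hB : ∀ x, |g x| ≤ B)
    (t a : ℝ) :
    Integrable (fun x => Real.exp (t * (g x - a))) μ := by
  refine integrable_of_forall_abs_le (by fun_prop) (B := Real.exp (|t| * (B + |a|))) fun x => ?_
  rw [abs_of_pos (Real.exp_pos _), Real.exp_le_exp]
  calc t * (g x - a) ≤ |t * (g x - a)| := le_abs_self _
    _ = |t| * |g x - a| := abs_mul _ _
    _ ≤ |t| * (|g x| + |a|) := by gcongr; exact abs_sub _ _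
    _ ≤ _ := by gcongr; exact hB x

/-- Exponential moment form of McDiarmid's bounded differences inequality. -/
theorem integral_exp_le_of_bounded_differences {X : Type*} [MeasurableSpace X] (ν : Measure X)
    [IsProbabilityMeasure ν] (m : ℕ) (g : (Fin m → X) → ℝ) (hg : Measurable g) (B : ℝ)
    (hB : ∀ x, |g x| ≤ B) (c : Fin m → ℝ≥0)
    (hc : ∀ x i y, |g (Function.update x i y) - g x| ≤ c i) (t : ℝ) :
    ∫ x, Real.exp (t * (g x - ∫ y, g y ∂(Measure.pi fun _ => ν))) ∂(Measure.pi fun _ => ν) ≤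
      Real.exp ((∑ i, ((c i : ℝ) / 2) ^ 2) * t ^ 2 / 2) := by
  induction m with
  | zero =>
    rw [Measure.pi_of_empty (fun _ : Fin 0 => ν) (default : Fin 0 → X)]
    have : ∀ x : Fin 0 → X, g x = g default := fun x => by rw [Subsingleton.elim x default]
    simp [this]
  | succ m ih =>
    set μ : Measure (Fin m → X) := Measure.pi fun _ => ν with hμ
    have hmp := measurePreserving_piFinSuccAbove (fun _ : Fin (m + 1) => ν) 0
    have htrans : ∀ F : (Fin (m + 1) → X) → ℝ,
        ∫ x, F x ∂(Measure.pi fun _ => ν) = ∫ z : X × (Fin m → X), F (Fin.cons z.1 z.2) ∂(ν.prod μ) := by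
      intro F
      have := hmp.symm.integral_comp' F
      rw [← this]
      refine integral_congr_ae (ae_of_all _ fun z => ?_)
      simp [MeasurableEquiv.piFinSuccAbove, Fin.insertNthEquiv]
    have hcons : Measurable fun z : X × (Fin m → X) => (Fin.cons z.1 z.2 : Fin (m + 1) → X) := by
      refine measurable_pi_iff.2 fun i => ?_
      refine Fin.cases ?_ (fun j => ?_) i
      · simpa using measurable_fst
      · simpa [Function.comp_def] using
          (measurable_pi_apply (X := fun _ : Fin m => X) j).comp measurable_snd
    set G : X × (Fin m → X) → ℝ := fun z => g (Fin.cons z.1 z.2) with hG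
    have hGm : Measurable G := hg.comp hcons
    have hGB : ∀ z, |G z| ≤ B := fun z => hB _
    -- Averaging out the first coordinate preserves the oscillation bounds in the others, so
    -- induction controls `h`; for fixed `x`, Hoeffding's lemma controls `G (·, x) - h x`.
    set h : (Fin m → X) → ℝ := fun x => ∫ a, G (a, x) ∂ν with hh
    have hGx : ∀ x, Measurable fun a => G (a, x) := fun x => hGm.comp (by fun_prop)
    have hint : ∀ x, Integrable (fun a => G (a, x)) ν := fun x =>
      integrable_of_forall_abs_le (hGx x) fun a => hGB _
    have hhm : Measurable h :=
      (hGm.stronglyMeasurable.integral_prod_left').measurable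
    have hhB : ∀ x, |h x| ≤ B := fun x => by
      have := norm_integral_le_of_norm_le_const (μ := ν) (f := fun a => G (a, x)) (C := B)
        (ae_of_all _ fun a => hGB _)
      simpa using this
    have hhc : ∀ x i y, |h (Function.update x i y) - h x| ≤ c i.succ := fun x i y => by
      rw [hh, ← integral_sub (hint _) (hint _)]
      have := norm_integral_le_of_norm_le_const (μ := ν)
        (f := fun a => G (a, Function.update x i y) - G (a, x)) (C := c i.succ)
        (ae_of_all _ fun a => by
          rw [Real.norm_eq_abs]
          have := hc (Fin.cons a x) i.succ y
          rwa [← Fin.cons_update] at this)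
      simpa using this
    have hmean : ∫ y, g y ∂(Measure.pi fun _ => ν) = ∫ x, h x ∂μ := by
      rw [htrans]
      exact integral_prod_symm _ (integrable_of_forall_abs_le hGm hGB)
    rw [hmean, htrans]
    set E := ∫ x, h x ∂μ
    have hexpint : Integrable (fun z => Real.exp (t * (G z - E))) (ν.prod μ) :=
      integrable_exp_of_forall_abs_le hGm hGB t E
    rw [integral_prod_symm _ hexpint]
    have hinner : ∀ x, ∫ a, Real.exp (t * (G (a, x) - E)) ∂ν ≤
        Real.exp (((c 0 : ℝ) / 2) ^ 2 * t ^ 2 / 2) * Real.exp (t * (h x - E)) := by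
      intro x
      have hsub := (hasSubgaussianMGF_of_osc_le ν (hGx x) (c := c 0) fun a b => by
        have := hc (Fin.cons a x) 0 b
        rwa [Fin.update_cons_zero] at this).mgf_le t
      have e : ∀ a, Real.exp (t * (G (a, x) - E)) =
          Real.exp (t * (G (a, x) - h x)) * Real.exp (t * (h x - E)) := fun a => by
        rw [← Real.exp_add]; ring_nf
      simp only [e]
      rw [integral_mul_const]
      gcongr
      simpa [mgf] using hsub
    calc ∫ x, ∫ a, Real.exp (t * (G (a, x) - E)) ∂ν ∂μ
        ≤ ∫ x, Real.exp (((c 0 : ℝ) / 2) ^ 2 * t ^ 2 / 2) * Real.exp (t * (h x - E)) ∂μ :=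
          integral_mono hexpint.integral_prod_right
            ((integrable_exp_of_forall_abs_le hhm hhB t E).const_mul _) hinner
      _ = Real.exp (((c 0 : ℝ) / 2) ^ 2 * t ^ 2 / 2) * ∫ x, Real.exp (t * (h x - E)) ∂μ :=
          integral_const_mul _ _
      _ ≤ Real.exp (((c 0 : ℝ) / 2) ^ 2 * t ^ 2 / 2) *
          Real.exp ((∑ i : Fin m, ((c i.succ : ℝ) / 2) ^ 2) * t ^ 2 / 2) := by
          gcongr
          exact ih h hhm hhB (fun i => c i.succ) hhc
      _ = _ := by
          rw [← Real.exp_add, Fin.sum_univ_succ]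
          ring_nf

/-- The sub-Gaussian form allows summation over independent samples afterwards. `B` serves
integrability only and does not enter the parameter. -/
theorem hasSubgaussianMGF_of_bounded_differences {X : Type*} [MeasurableSpace X] (ν : Measure X)
    [IsProbabilityMeasure ν] {m : ℕ} {g : (Fin m → X) → ℝ} (hg : Measurable g) {B : ℝ}
    (hB : ∀ x, |g x| ≤ B) {c : ℝ≥0}
    (hc : ∀ x i y, |g (Function.update x i y) - g x| ≤ c) :
    HasSubgaussianMGF (fun x => g x - ∫ y, g y ∂(Measure.pi fun _ => ν)) (m * (c / 2) ^ 2)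
      (Measure.pi fun _ => ν) where
  integrable_exp_mul t := integrable_exp_of_forall_abs_le hg hB t _
  mgf_le t := by
    have := integral_exp_le_of_bounded_differences ν m g hg B hB (fun _ => c) hc t
    simpa [mgf] using this

end BoundedDifferences

/-! ### Deterministic stability of basis pursuit and support identification. -/

section Recovery

variable {ι κ : Type*} [Fintype ι] [Fintype κ]

lemma l2Norm_eq_norm (x : ι → ℝ) : l2Norm x = ‖WithLp.toLp 2 x‖ := by
  simp [l2Norm, EuclideanSpace.norm_eq]

lemma l2Norm_sub_le (x y : ι → ℝ) : l2Norm (x - y) ≤ l2Norm x + l2Norm y := by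
  simp only [l2Norm_eq_norm, WithLp.toLp_sub]
  exact norm_sub_le _ _

lemma sum_mul_le_l2Norm_mul (x y : ι → ℝ) : ∑ i, x i * y i ≤ l2Norm x * l2Norm y := by
  exact Real.sum_mul_le_sqrt_mul_sqrt _ _ _

lemma l2Norm_nonneg (x : ι → ℝ) : 0 ≤ l2Norm x := Real.sqrt_nonneg _

lemma sq_l2Norm (x : ι → ℝ) : l2Norm x ^ 2 = ∑ i, x i ^ 2 :=
  Real.sq_sqrt (Finset.sum_nonneg fun _ _ => sq_nonneg _)

lemma l1Norm_nonneg (x : ι → ℝ) : 0 ≤ l1Norm x := Finset.sum_nonneg fun _ _ => abs_nonneg _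

lemma sum_mulVec_mul_mulVec (A : Matrix ι κ ℝ) (x y : κ → ℝ) :
    ∑ r, A.mulVec x r * A.mulVec y r = ∑ a, ∑ b, x a * y b * ∑ r, A r a * A r b := by
  simp only [Matrix.mulVec, dotProduct, Finset.sum_mul_sum]
  rw [Finset.sum_comm]
  refine Finset.sum_congr rfl fun a _ => ?_
  rw [Finset.sum_comm]
  refine Finset.sum_congr rfl fun b _ => ?_
  rw [Finset.mul_sum]
  exact Finset.sum_congr rfl fun r _ => by ring

/-- The restriction of a vector to an index set, extended by zero. -/
noncomputable def restrictTo [DecidableEq κ] (S : Finset κ) (h : κ → ℝ) : κ → ℝ :=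
  fun j => if j ∈ S then h j else 0

variable [DecidableEq κ]

lemma l1Norm_restrictTo (S : Finset κ) (h : κ → ℝ) :
    l1Norm (restrictTo S h) = ∑ j ∈ S, |h j| := by
  simp [l1Norm, restrictTo, apply_ite abs, Finset.sum_ite_mem]

lemma sq_l1Norm_restrictTo_le (S : Finset κ) (h : κ → ℝ) :
    l1Norm (restrictTo S h) ^ 2 ≤ S.card * l2Norm (restrictTo S h) ^ 2 := by
  have e : l2Norm (restrictTo S h) ^ 2 = ∑ j ∈ S, |h j| ^ 2 := by
    rw [sq_l2Norm]
    simp [restrictTo, ite_pow, Finset.sum_ite_mem]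
  rw [l1Norm_restrictTo, e]
  exact sq_sum_le_card_mul_sum_sq

/-- The cone condition satisfied by `c - z` when `c` is supported on `S` and
`‖z‖₁ ≤ ‖c‖₁`. -/
lemma l1Norm_sub_le_two_mul {S : Finset κ} {c z : κ → ℝ} (hS : ∀ j ∉ S, c j = 0)
    (hz : l1Norm z ≤ l1Norm c) :
    l1Norm (c - z) ≤ 2 * l1Norm (restrictTo S (c - z)) := by
  rw [l1Norm_restrictTo]
  simp only [l1Norm, Pi.sub_apply] at hz ⊢
  rw [Finset.mul_sum, ← Finset.sum_add_sum_compl S]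
  rw [← Finset.sum_add_sum_compl S, ← Finset.sum_add_sum_compl S (fun j => |c j|)] at hz
  have h1 : ∑ j ∈ Sᶜ, |c j| = 0 :=
    Finset.sum_eq_zero fun j hj => by rw [hS j (Finset.mem_compl.1 hj), abs_zero]
  have h2 : ∑ j ∈ Sᶜ, |c j - z j| = ∑ j ∈ Sᶜ, |z j| :=
    Finset.sum_congr rfl fun j hj => by rw [hS j (Finset.mem_compl.1 hj), zero_sub, abs_neg]
  have h3 : ∑ j ∈ S, |c j| ≤ ∑ j ∈ S, |z j| + ∑ j ∈ S, |c j - z j| := by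
    rw [← Finset.sum_add_distrib]
    refine Finset.sum_le_sum fun j _ => ?_
    have := abs_add_le (z j) (c j - z j)
    rwa [add_sub_cancel] at this
  rw [← Finset.mul_sum]
  linarith

/-- If the Gram matrix of the columns of `A` is entrywise `M * τ`-close to `M` times the
identity, then `⟨A x, A y⟩` is close to `M * ⟨x, y⟩`. -/
lemma abs_sum_mulVec_mul_mulVec_sub_le {A : Matrix ι κ ℝ} {M τ : ℝ}
    (hA : ∀ a b, |∑ r, A r a * A r b - M * (if a = b then 1 else 0)| ≤ M * τ) (x y : κ → ℝ) :
    |∑ r, A.mulVec x r * A.mulVec y r - M * ∑ a, x a * y a| ≤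
      M * τ * (l1Norm x * l1Norm y) := by
  have e : ∑ r, A.mulVec x r * A.mulVec y r - M * ∑ a, x a * y a =
      ∑ a, ∑ b, x a * y b * (∑ r, A r a * A r b - M * (if a = b then 1 else 0)) := by
    rw [sum_mulVec_mul_mulVec]
    simp only [mul_sub, Finset.sum_sub_distrib]
    congr 1
    simp only [mul_ite, mul_one, mul_zero, Finset.sum_ite_eq, Finset.mem_univ, if_true,
      Finset.mul_sum]
    exact Finset.sum_congr rfl fun a _ => by ring
  rw [e, l1Norm, l1Norm, Finset.sum_mul_sum, Finset.mul_sum]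
  refine (Finset.abs_sum_le_sum_abs _ _).trans (Finset.sum_le_sum fun a _ => ?_)
  rw [Finset.mul_sum]
  refine (Finset.abs_sum_le_sum_abs _ _).trans (Finset.sum_le_sum fun b _ => ?_)
  rw [abs_mul, abs_mul, mul_comm]
  gcongr
  exact hA a b

/-- Stability of basis pursuit under an incoherence condition. -/
theorem l1Norm_sub_le_of_gram {A : Matrix ι κ ℝ} {M : ℝ} (hM : 1 ≤ M) {s : ℕ} (hs : 1 ≤ s)
    (hA : ∀ a b, |∑ r, A r a * A r b - M * (if a = b then 1 else 0)| ≤ M * (1 / (5 / 2 * s)))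
    {S : Finset κ} (hScard : S.card ≤ s) {c z : κ → ℝ} (hS : ∀ j ∉ S, c j = 0)
    {V : ι → ℝ} {σ : ℝ} (hc : l2Norm (A.mulVec c - V) ≤ σ) (hz : IsBPMinimizer A V σ z) :
    l1Norm (c - z) ≤ 24 * s * σ := by
  have hs' : (1 : ℝ) ≤ s := by exact_mod_cast hs
  set τ : ℝ := 1 / (5 / 2 * s) with hτ
  have hτ0 : 0 ≤ τ := by positivity
  have hτs : τ * s = 2 / 5 := by rw [hτ]; field_simp
  have hσ : 0 ≤ σ := (l2Norm_nonneg _).trans hc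
  set h := c - z with hh
  set g := restrictTo S h with hg
  have hcone : l1Norm h ≤ 2 * l1Norm g := l1Norm_sub_le_two_mul hS (hz.2 c hc)
  set q := l1Norm g with hq
  set e := l2Norm g with he
  have hq0 : 0 ≤ q := l1Norm_nonneg _
  have he0 : 0 ≤ e := l2Norm_nonneg _
  have hqe : q ^ 2 ≤ s * e ^ 2 := (sq_l1Norm_restrictTo_le S h).trans (by gcongr)
  have hres : l2Norm (A.mulVec h) ≤ 2 * σ := by
    have : A.mulVec h = (A.mulVec c - V) - (A.mulVec z - V) := by
      rw [hh, Matrix.mulVec_sub]; abel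
    rw [this]
    have := l2Norm_sub_le (A.mulVec c - V) (A.mulVec z - V)
    linarith [hz.1]
  have hgg : ∑ a, g a * g a = e ^ 2 := by
    rw [he, sq_l2Norm]; exact Finset.sum_congr rfl fun _ _ => by ring
  have hgh : ∑ a, g a * h a = e ^ 2 := by
    rw [← hgg]
    refine Finset.sum_congr rfl fun a _ => ?_
    simp only [hg, restrictTo]
    split_ifs <;> simp
  have hτq : τ * q ^ 2 ≤ 2 / 5 * e ^ 2 := by
    calc τ * q ^ 2 ≤ τ * (s * e ^ 2) := by gcongr
      _ = τ * s * e ^ 2 := by ring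
      _ = _ := by rw [hτs]
  have hupper : l2Norm (A.mulVec g) ^ 2 ≤ M * (7 / 5 * e ^ 2) := by
    have h1 := (abs_le.1 (abs_sum_mulVec_mul_mulVec_sub_le hA g g)).2
    rw [hgg] at h1
    have h2 : l2Norm (A.mulVec g) ^ 2 = ∑ r, A.mulVec g r * A.mulVec g r := by
      rw [sq_l2Norm]; exact Finset.sum_congr rfl fun _ _ => by ring
    rw [h2]
    have h3 : M * (τ * q ^ 2) ≤ M * (2 / 5 * e ^ 2) := by gcongr
    have h4 : M * τ * (l1Norm g * l1Norm g) = M * (τ * q ^ 2) := by rw [← hq]; ring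
    linarith
  -- Pairing `A g` with `A h`, rather than squaring `A h`, keeps the coherence error at `2 τ q² ≤
  -- (4/5) e²`, below the main term `⟨g, h⟩ = e²`; squaring would double it and lose positivity.
  have hlower : M * (1 / 5 * e ^ 2) ≤ l2Norm (A.mulVec g) * (2 * σ) := by
    have h1 := (abs_le.1 (abs_sum_mulVec_mul_mulVec_sub_le hA g h)).1
    rw [hgh] at h1
    have h2 : M * τ * (l1Norm g * l1Norm h) ≤ M * (4 / 5 * e ^ 2) := by
      calc M * τ * (l1Norm g * l1Norm h) ≤ M * τ * (q * (2 * q)) := by gcongr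
        _ = M * (2 * (τ * q ^ 2)) := by ring
        _ ≤ M * (2 * (2 / 5 * e ^ 2)) := by gcongr
        _ = _ := by ring
    have h3 := sum_mul_le_l2Norm_mul (A.mulVec g) (A.mulVec h)
    have h4 : l2Norm (A.mulVec g) * l2Norm (A.mulVec h) ≤ l2Norm (A.mulVec g) * (2 * σ) :=
      mul_le_mul_of_nonneg_left hres (l2Norm_nonneg _)
    linarith
  -- Squaring `hlower` and inserting `hupper` gives `25 · (7/5) · 4 = 140`, which is below `12²`.
  have hesq : M * e ^ 2 ≤ 140 * σ ^ 2 := by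
    rcases he0.eq_or_lt with h0 | h0
    · rw [h0.symm]
      simp only [ne_eq, OfNat.ofNat_ne_zero, not_false_eq_true, zero_pow, mul_zero]
      positivity
    have h1 : (M * (1 / 5 * e ^ 2)) ^ 2 ≤ (l2Norm (A.mulVec g) * (2 * σ)) ^ 2 := by gcongr
    have h2 : (l2Norm (A.mulVec g) * (2 * σ)) ^ 2 ≤ M * (7 / 5 * e ^ 2) * (2 * σ) ^ 2 := by
      rw [mul_pow]; gcongr
    have h3 : (M * e ^ 2) * (M * e ^ 2) ≤ (M * e ^ 2) * (140 * σ ^ 2) := by nlinarith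
    exact le_of_mul_le_mul_left h3 (by positivity)
  have hesq' : e ^ 2 ≤ (12 * σ) ^ 2 := by nlinarith [sq_nonneg e, sq_nonneg σ]
  -- Cauchy–Schwarz would give `√s`; `s ≤ s²` weakens it to `s`. The cone condition doubles `12` to
  -- `24`.
  have hq2 : q ≤ 12 * s * σ := by
    refine abs_le_of_sq_le_sq' ?_ (by positivity) |>.2
    calc q ^ 2 ≤ s * e ^ 2 := hqe
      _ ≤ s * s * (12 * σ) ^ 2 := by
        have : (s : ℝ) ≤ s * s := by nlinarith
        exact mul_le_mul this hesq' (sq_nonneg _) (by positivity)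
      _ = _ := by ring
  linarith

/-- A sufficiently accurate approximation in `ℓ¹` identifies the support. -/
theorem eq_supp_of_isLargestSet {c z : κ → ℝ} {ε : ℝ} (hz : l1Norm (c - z) ≤ ε)
    (hc : ∀ j ∈ supp c, ε < |c j| / 2) {T : Finset κ} (hT : IsLargestSet z (supp c).card T) :
    T = supp c := by
  by_contra hne
  obtain ⟨j, hjS, hjT⟩ : ∃ j ∈ supp c, j ∉ T := by
    by_contra! hcon
    exact hne (Finset.eq_of_subset_of_card_le hcon hT.1.le).symm
  obtain ⟨l, hlT, hlS⟩ : ∃ l ∈ T, l ∉ supp c := by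
    by_contra! hcon
    exact hne (Finset.eq_of_subset_of_card_le hcon hT.1.ge)
  have hlj : l ≠ j := fun h => hlS (h ▸ hjS)
  have hcl : c l = 0 := by simpa [supp] using hlS
  -- Both errors count in one `ℓ¹` norm and `|z j| ≤ |z l|`, so `|c j| ≤ |c j - z j| + |z l| ≤ ε`,
  -- contradicting `hc`.
  have h1 : |c j - z j| + |c l - z l| ≤ ε := by
    refine le_trans ?_ hz
    rw [← Finset.sum_pair (f := fun i => |c i - z i|) hlj.symm]
    exact Finset.sum_le_univ_sum_of_nonneg fun i => abs_nonneg _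
  have h2 := hT.2 l hlT j hjT
  rw [hcl, zero_sub, abs_neg] at h1
  have h3 := abs_sub_abs_le_abs_sub (c j) (z j)
  have h4 := hc j hjS
  linarith [abs_nonneg (c j)]

end Recovery

/-! ### Concentration of the Gram entries under uniform sampling. -/

section Sampling

open MeasureTheory ProbabilityTheory
open scoped NNReal

/-- A multi-index is a multiset of at most `p` coordinates; padding with `none` gives size exactly
`p`, and listing it injects into words of length `p` over `n + 1` letters. -/
lemma card_multiIndex_le (n p : ℕ) : Fintype.card (MultiIndex n p) ≤ (n + 1) ^ p := by
  classical
  let m : MultiIndex n p → Multiset (Option (Fin n)) := fun α =>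
    ∑ i, (α.1 i : ℕ) • {some i} + Multiset.replicate (p - ∑ i, (α.1 i : ℕ)) none
  have hm : ∀ α, (m α).card = p := fun α => by
    have := α.2
    simp only [m, Multiset.card_add, Multiset.card_sum, Multiset.card_nsmul, Multiset.card_singleton,
      Multiset.card_replicate, mul_one]
    omega
  have hcount : ∀ α j, (m α).count (some j) = α.1 j := fun α j => by
    simp [m, Multiset.count_sum', Multiset.count_singleton, Multiset.count_replicate]
  let F : MultiIndex n p → List.Vector (Option (Fin n)) p := fun α =>
    ⟨(m α).toList, by rw [Multiset.length_toList, hm]⟩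
  have hF : Function.Injective F := fun α β h => by
    have h1 : (m α).toList = (m β).toList := congrArg Subtype.val h
    have h2 : m α = m β := by rw [← Multiset.coe_toList (m α), h1, Multiset.coe_toList]
    refine Subtype.ext (funext fun j => Fin.ext ?_)
    rw [← hcount, ← hcount, h2]
  have := Fintype.card_le_of_injective F hF
  simpa [card_vector] using this

/-- The uniform probability measure on `[-1, 1]`. -/
noncomputable def uniformInterval : Measure ℝ := (2 : ENNReal)⁻¹ • volume.restrict (Set.Icc (-1) 1)

instance : IsProbabilityMeasure uniformInterval :=
  ⟨by
    have h : (1 : ℝ) - -1 = 2 := by norm_num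
    simp only [uniformInterval, Measure.smul_apply, Measure.restrict_apply MeasurableSet.univ,
      Set.univ_inter, Real.volume_Icc, h, smul_eq_mul, ENNReal.ofReal_ofNat]
    exact ENNReal.inv_mul_cancel (by norm_num) (by norm_num)⟩

lemma cond_box_eq_pi (n : ℕ) :
    cond (volume : Measure (Fin n → ℝ)) (Set.Icc (-1) 1) =
      Measure.pi fun _ : Fin n => uniformInterval := by
  have hbox : (Set.Icc (-1 : Fin n → ℝ) 1) = Set.univ.pi fun _ => Set.Icc (-1 : ℝ) 1 := by
    rw [← Set.pi_univ_Icc]; rfl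
  symm
  refine Measure.pi_eq fun s hs => ?_
  have h2 : ENNReal.ofReal ((1 : ℝ) - -1) = 2 := by norm_num
  rw [cond_apply measurableSet_Icc, hbox, ← Set.pi_inter_distrib, volume_pi_pi, volume_pi_pi]
  simp only [Real.volume_Icc, h2, uniformInterval, Measure.smul_apply, smul_eq_mul,
    Finset.prod_mul_distrib, Finset.prod_const]
  congr 1
  · rw [ENNReal.inv_pow]
  · refine Finset.prod_congr rfl fun i _ => ?_
    rw [Measure.restrict_apply (hs i), Set.inter_comm]

lemma integral_uniformInterval (g : ℝ → ℝ) :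
    ∫ x, g x ∂uniformInterval = (1 / 2) * ∫ x in (-1 : ℝ)..1, g x := by
  rw [uniformInterval, integral_smul_measure, intervalIntegral.integral_of_le (by norm_num),
    integral_Icc_eq_integral_Ioc]
  simp

/-- The coordinatewise projection onto `[-1, 1]`. -/
def clamp {n : ℕ} (x : Fin n → ℝ) : Fin n → ℝ := fun i => max (-1) (min 1 (x i))

lemma clamp_mem {n : ℕ} (x : Fin n → ℝ) (i : Fin n) : clamp x i ∈ Set.Icc (-1 : ℝ) 1 :=
  ⟨le_max_left _ _, max_le (by norm_num) (min_le_left _ _)⟩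

/-- Clamping makes the bounds hold everywhere, as the bounded differences lemma requires, yet
changes nothing almost surely. -/
lemma clamp_eq_self {n : ℕ} {x : Fin n → ℝ} (hx : x ∈ Set.Icc (-1 : Fin n → ℝ) 1) :
    clamp x = x := by
  funext i
  have h1 := hx.1 i
  have h2 := hx.2 i
  simp only [Pi.neg_apply, Pi.one_apply] at h1 h2
  simp [clamp, h1, h2]

lemma clamp_update_of_ne {n : ℕ} (x : Fin n → ℝ) {i j : Fin n} (y : ℝ) (h : i ≠ j) :
    clamp (Function.update x j y) i = clamp x i := by
  simp [clamp, Function.update_of_ne h]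

@[fun_prop]
lemma continuous_clamp {n : ℕ} : Continuous (clamp : (Fin n → ℝ) → Fin n → ℝ) := by
  unfold clamp; fun_prop

@[fun_prop]
lemma continuous_tensorLegendre {n p : ℕ} (α : MultiIndex n p) :
    Continuous (tensorLegendre α) := by
  unfold tensorLegendre; fun_prop

@[fun_prop]
lemma continuous_cyclicShift {n : ℕ} (a : Fin n) :
    Continuous (cyclicShift a : (Fin n → ℝ) → Fin n → ℝ) := by
  unfold cyclicShift; fun_prop

lemma two_mul_add_one_le_three_pow (a : ℕ) : 2 * (a : ℝ) + 1 ≤ 3 ^ a := by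
  have := one_add_mul_le_pow (a := (2 : ℝ)) (by norm_num) a
  norm_num at this
  linarith

/-- Each factor is at most `√(2a + 1) ≤ √3^a` with `a = α_i`, and the exponents add up to at most
`p`, so the bound does not depend on `n`. -/
lemma abs_tensorLegendre_le {n p : ℕ} (α : MultiIndex n p) {x : Fin n → ℝ}
    (hx : ∀ i, x i ∈ Set.Icc (-1 : ℝ) 1) : |tensorLegendre α x| ≤ Real.sqrt 3 ^ p := by
  have h3 : 1 ≤ Real.sqrt 3 := Real.one_le_sqrt.2 (by norm_num)
  calc |tensorLegendre α x|
      = ∏ i, |Real.sqrt (2 * ((α.1 i : ℕ) : ℝ) + 1) * (legendre (α.1 i : ℕ)).eval (x i)| :=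
        Finset.abs_prod _ _
    _ ≤ ∏ i, Real.sqrt 3 ^ (α.1 i : ℕ) := by
        refine Finset.prod_le_prod (fun _ _ => abs_nonneg _) fun i _ => ?_
        rw [abs_mul, abs_of_nonneg (Real.sqrt_nonneg _), ← mul_one (Real.sqrt 3 ^ _)]
        refine mul_le_mul ?_ (abs_eval_legendre_le_one _ (hx i)) (abs_nonneg _) (by positivity)
        refine Real.sqrt_le_iff.2 ⟨by positivity, ?_⟩
        rw [← pow_mul, mul_comm (α.1 i : ℕ), pow_mul, Real.sq_sqrt (by norm_num)]
        exact two_mul_add_one_le_three_pow _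
    _ = Real.sqrt 3 ^ (∑ i, (α.1 i : ℕ)) := Finset.prod_pow_eq_pow_sum _ _ _
    _ ≤ Real.sqrt 3 ^ p := pow_le_pow_right₀ h3 α.2

lemma abs_tensorLegendre_mul_le {n p : ℕ} (α β : MultiIndex n p) {x : Fin n → ℝ}
    (hx : ∀ i, x i ∈ Set.Icc (-1 : ℝ) 1) : |tensorLegendre α x * tensorLegendre β x| ≤ 3 ^ p := by
  have e : (3 : ℝ) ^ p = Real.sqrt 3 ^ p * Real.sqrt 3 ^ p := by
    rw [← mul_pow, Real.mul_self_sqrt (by norm_num)]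
  rw [abs_mul, e]
  exact mul_le_mul (abs_tensorLegendre_le α hx) (abs_tensorLegendre_le β hx) (abs_nonneg _)
    (by positivity)

/-- The coordinates on which the tensorized Legendre polynomial of index `α` depends. -/
def activeCoords {n p : ℕ} (α : MultiIndex n p) : Finset (Fin n) := {i | (α.1 i : ℕ) ≠ 0}

lemma card_activeCoords_le {n p : ℕ} (α : MultiIndex n p) : (activeCoords α).card ≤ p := by
  refine le_trans ?_ α.2
  rw [activeCoords, Finset.card_filter]
  refine Finset.sum_le_sum fun i _ => ?_
  split_ifs <;> omega

lemma tensorLegendre_congr {n p : ℕ} (α : MultiIndex n p) {x y : Fin n → ℝ}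
    (h : ∀ i ∈ activeCoords α, x i = y i) : tensorLegendre α x = tensorLegendre α y := by
  refine Finset.prod_congr rfl fun i _ => ?_
  by_cases hi : i ∈ activeCoords α
  · rw [h i hi]
  · have : (α.1 i : ℕ) = 0 := by simpa [activeCoords] using hi
    rw [this]
    simp [legendre]

/-- The sum, over all cyclic shifts, of the product of two basis functions. -/
noncomputable def shiftCorrelation {n p : ℕ} (α β : MultiIndex n p) (x : Fin n → ℝ) : ℝ :=
  ∑ i, tensorLegendre α (cyclicShift i x) * tensorLegendre β (cyclicShift i x)

lemma cyclicShift_clamp_mem {n : ℕ} (i : Fin n) (x : Fin n → ℝ) (l : Fin n) :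
    cyclicShift i (clamp x) l ∈ Set.Icc (-1 : ℝ) 1 := clamp_mem x _

lemma measurable_shiftCorrelation_clamp {n p : ℕ} (α β : MultiIndex n p) :
    Measurable fun x => shiftCorrelation α β (clamp x) := by
  refine Continuous.measurable ?_
  unfold shiftCorrelation
  fun_prop

lemma abs_shiftCorrelation_clamp_le {n p : ℕ} (α β : MultiIndex n p) (x : Fin n → ℝ) :
    |shiftCorrelation α β (clamp x)| ≤ n * 3 ^ p := by
  refine (Finset.abs_sum_le_sum_abs _ _).trans ?_
  refine (Finset.sum_le_sum fun i _ =>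
    abs_tensorLegendre_mul_le α β (cyclicShift_clamp_mem i x)).trans ?_
  simp

/-- The `i`-th shift sees coordinate `j` at position `j - i`, so only the at most `2p` shifts
placing it in an active coordinate of `α` or `β` change. -/
lemma abs_shiftCorrelation_clamp_update_sub_le {n p : ℕ} [NeZero n] (α β : MultiIndex n p)
    (x : Fin n → ℝ) (j : Fin n) (y : ℝ) :
    |shiftCorrelation α β (clamp (Function.update x j y)) - shiftCorrelation α β (clamp x)| ≤
      4 * p * 3 ^ p := by
  set U := activeCoords α ∪ activeCoords β with hU
  have hUcard : U.card ≤ 2 * p := by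
    have h1 := card_activeCoords_le α
    have h2 := card_activeCoords_le β
    refine (Finset.card_union_le _ _).trans ?_
    omega
  have hcard : ((Finset.univ : Finset (Fin n)).filter fun i => j - i ∈ U).card ≤ U.card := by
    refine Finset.card_le_card_of_injOn (fun i => j - i) (fun i hi => ?_) fun a _ b _ h => ?_
    · simpa using hi
    · exact sub_right_injective h
  rw [shiftCorrelation, shiftCorrelation, ← Finset.sum_sub_distrib]
  refine (Finset.abs_sum_le_sum_abs _ _).trans ?_
  have hterm : ∀ i : Fin n, |tensorLegendre α (cyclicShift i (clamp (Function.update x j y))) *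
      tensorLegendre β (cyclicShift i (clamp (Function.update x j y))) -
      tensorLegendre α (cyclicShift i (clamp x)) * tensorLegendre β (cyclicShift i (clamp x))| ≤
      if j - i ∈ U then 2 * 3 ^ p else 0 := by
    intro i
    split_ifs with hi
    · refine (abs_sub _ _).trans ?_
      have h1 := abs_tensorLegendre_mul_le α β
        (cyclicShift_clamp_mem i (Function.update x j y))
      have h2 := abs_tensorLegendre_mul_le α β (cyclicShift_clamp_mem i x)
      linarith
    · have h : ∀ l ∈ U, cyclicShift i (clamp (Function.update x j y)) l =
          cyclicShift i (clamp x) l := fun l hl => by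
        refine clamp_update_of_ne x y fun h => hi ?_
        rw [← h, add_sub_cancel_right]
        exact hl
      rw [tensorLegendre_congr α fun l hl => h l (Finset.mem_union_left _ hl),
        tensorLegendre_congr β fun l hl => h l (Finset.mem_union_right _ hl), sub_self, abs_zero]
  refine (Finset.sum_le_sum fun i _ => hterm i).trans ?_
  rw [← Finset.sum_filter, Finset.sum_const, nsmul_eq_mul]
  have : (((Finset.univ : Finset (Fin n)).filter fun i => j - i ∈ U).card : ℝ) ≤ 2 * p := by
    exact_mod_cast hcard.trans hUcard
  calc _ ≤ 2 * (p : ℝ) * (2 * 3 ^ p) := by gcongr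
    _ = _ := by ring

lemma ae_mem_box (n : ℕ) :
    ∀ᵐ x ∂(Measure.pi fun _ : Fin n => uniformInterval), x ∈ Set.Icc (-1 : Fin n → ℝ) 1 := by
  rw [← cond_box_eq_pi]
  exact ae_cond_mem measurableSet_Icc

/-- Orthonormality of the tensorized Legendre polynomials, for every cyclic shift. -/
lemma integral_tensorLegendre_mul_cyclicShift {n p : ℕ} [NeZero n] (α β : MultiIndex n p)
    (i : Fin n) :
    ∫ x, tensorLegendre α (cyclicShift i x) * tensorLegendre β (cyclicShift i x)
      ∂(Measure.pi fun _ : Fin n => uniformInterval) = if α = β then 1 else 0 := by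
  let F : Fin n → ℝ → ℝ := fun l y =>
    (Real.sqrt (2 * ((α.1 l : ℕ) : ℝ) + 1) * (legendre (α.1 l : ℕ)).eval y) *
      (Real.sqrt (2 * ((β.1 l : ℕ) : ℝ) + 1) * (legendre (β.1 l : ℕ)).eval y)
  have hF : ∀ l, ∫ y, F l y ∂uniformInterval = if α.1 l = β.1 l then 1 else 0 := fun l => by
    rw [integral_uniformInterval, integral_legendre_mul_legendre]
    simp only [Fin.val_inj]
    split_ifs <;> norm_num
  have e : ∀ x : Fin n → ℝ, tensorLegendre α (cyclicShift i x) *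
      tensorLegendre β (cyclicShift i x) = ∏ m, F (m - i) (x m) := fun x => by
    rw [tensorLegendre, tensorLegendre, ← Finset.prod_mul_distrib]
    refine Fintype.prod_equiv (Equiv.addRight i) _ _ fun l => ?_
    simp [F, cyclicShift]
  simp only [e]
  rw [integral_fintype_prod_eq_prod]
  simp only [hF]
  split_ifs with h
  · simp [h]
  · obtain ⟨l, hl⟩ : ∃ l, α.1 l ≠ β.1 l := by
      by_contra! hcon
      exact h (Subtype.ext (funext hcon))
    refine Finset.prod_eq_zero (Finset.mem_univ (l + i)) ?_
    simp [hl]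

lemma integral_shiftCorrelation_clamp {n p : ℕ} [NeZero n] (α β : MultiIndex n p) :
    ∫ x, shiftCorrelation α β (clamp x) ∂(Measure.pi fun _ : Fin n => uniformInterval) =
      n * if α = β then 1 else 0 := by
  unfold shiftCorrelation
  rw [integral_finsetSum _ fun i _ => ?_]
  · have : ∀ i : Fin n, ∫ x, tensorLegendre α (cyclicShift i (clamp x)) *
        tensorLegendre β (cyclicShift i (clamp x)) ∂(Measure.pi fun _ : Fin n => uniformInterval) =
        if α = β then 1 else 0 := fun i => by
      rw [← integral_tensorLegendre_mul_cyclicShift α β i]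
      refine integral_congr_ae ?_
      filter_upwards [ae_mem_box n] with x hx
      rw [clamp_eq_self hx]
    simp only [this, Finset.sum_const, Finset.card_univ, Fintype.card_fin, nsmul_eq_mul]
  · exact integrable_of_forall_abs_le (Continuous.measurable (by fun_prop)) fun x =>
      abs_tensorLegendre_mul_le α β (cyclicShift_clamp_mem i x)

variable {Ω : Type*} [MeasurableSpace Ω] {P : Measure Ω} [IsProbabilityMeasure P]

lemma volume_box_ne (n : ℕ) :
    volume (Set.Icc (-1 : Fin n → ℝ) 1) ≠ 0 ∧ volume (Set.Icc (-1 : Fin n → ℝ) 1) ≠ ⊤ := by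
  rw [Real.volume_Icc_pi]
  norm_num

/-- Concentration of the Gram matrix entries of the sampling matrix. -/
theorem measureReal_shiftCorrelation_ge_le {n p K : ℕ} [NeZero n] {y : Fin K → Ω → Fin n → ℝ}
    (hy : ∀ k, pdf.IsUniform (y k) (Set.Icc (-1 : Fin n → ℝ) 1) P volume)
    (hind : iIndepFun y P) (α β : MultiIndex n p) {ε : ℝ} (hε : 0 ≤ ε) :
    P.real {ω | ε ≤ |∑ k, shiftCorrelation α β (clamp (y k ω)) -
      (n * K : ℝ) * if α = β then 1 else 0|} ≤
      2 * Real.exp (-ε ^ 2 / (2 * (n * K * (2 * p * 3 ^ p) ^ 2))) := by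
  have hmap : ∀ k, P.map (y k) = Measure.pi fun _ : Fin n => uniformInterval := fun k => by
    rw [← cond_box_eq_pi]; exact hy k
  have hmeas : ∀ k, AEMeasurable (y k) P := fun k =>
    (hy k).aemeasurable (volume_box_ne n).1 (volume_box_ne n).2
  set a : ℝ := n * if α = β then 1 else 0 with ha
  set C : ℝ≥0 := 4 * p * 3 ^ p with hC
  let g : (Fin n → ℝ) → ℝ := fun x => shiftCorrelation α β (clamp x) - a
  have hg : Measurable g := (measurable_shiftCorrelation_clamp α β).sub_const _
  -- Dependence among the shifts of one sample is absorbed here; independence is needed only across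
  -- samples.
  have hsub : ∀ k, HasSubgaussianMGF (g ∘ y k) (n * (C / 2) ^ 2) P := fun k => by
    refine HasSubgaussianMGF.of_map (hmeas k) ?_
    rw [hmap]
    have := hasSubgaussianMGF_of_bounded_differences uniformInterval (c := C)
      (measurable_shiftCorrelation_clamp α β) (abs_shiftCorrelation_clamp_le α β)
      (fun x i z => by
        simpa [hC] using abs_shiftCorrelation_clamp_update_sub_le α β x i z)
    rwa [integral_shiftCorrelation_clamp] at this
  have hindg : iIndepFun (fun k => g ∘ y k) P := hind.comp (fun _ => g) fun _ => hg
  have hsum := HasSubgaussianMGF.sum_of_iIndepFun hindg (c := fun _ => n * (C / 2) ^ 2)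
    (s := Finset.univ) fun k _ => hsub k
  have hconst : ((∑ _k : Fin K, n * (C / 2) ^ 2 : ℝ≥0) : ℝ) = n * K * (2 * p * 3 ^ p) ^ 2 := by
    simp [hC]
    ring
  have hup := hsum.measure_ge_le hε
  have hlo := hsum.neg.measure_ge_le hε
  rw [hconst] at hup hlo
  have e : ∀ ω, ∑ k, (g ∘ y k) ω = ∑ k, shiftCorrelation α β (clamp (y k ω)) -
      (n * K : ℝ) * if α = β then 1 else 0 := fun ω => by
    simp only [g, Function.comp_apply, Finset.sum_sub_distrib, Finset.sum_const, Finset.card_univ,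
      Fintype.card_fin, nsmul_eq_mul, ha]
    ring
  simp only [Pi.neg_apply, e] at hup hlo
  have hcover : {ω | ε ≤ |∑ k, shiftCorrelation α β (clamp (y k ω)) -
        (n * K : ℝ) * if α = β then 1 else 0|} ⊆
      {ω | ε ≤ ∑ k, shiftCorrelation α β (clamp (y k ω)) -
        (n * K : ℝ) * if α = β then 1 else 0} ∪
      {ω | ε ≤ -(∑ k, shiftCorrelation α β (clamp (y k ω)) -
        (n * K : ℝ) * if α = β then 1 else 0)} := fun ω hω => by
    simpa only [Set.mem_union, Set.mem_ofPred_eq, le_abs] using hω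
  have h := (measureReal_mono (μ := P) hcover).trans (measureReal_union_le _ _)
  linarith

/-- The bad set need not be measurable, so the event is the complement of its measurable hull. -/
lemma exists_measurableSet_of_measureReal_lt {bad : Set Ω} {δ : ℝ} (h : P.real bad < δ) :
    ∃ E : Set Ω, MeasurableSet E ∧ 1 - δ < P.real E ∧ ∀ ω ∈ E, ω ∉ bad := by
  refine ⟨(toMeasurable P bad)ᶜ, (measurableSet_toMeasurable _ _).compl, ?_, fun ω hω hb =>
    hω (subset_toMeasurable _ _ hb)⟩
  rw [probReal_compl_eq_one_sub (measurableSet_toMeasurable _ _), measureReal_def,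
    measure_toMeasurable]
  rw [measureReal_def] at h
  linarith

end Sampling

/-! ### Numerical estimate for the union bound. -/

section Estimate

lemma log_natCast_le {p : ℕ} (hp : 1 ≤ p) : Real.log p ≤ (p - 1) * Real.log 2 := by
  have h : (p : ℝ) ≤ 2 ^ (p - 1) := by
    have : p ≤ 2 ^ (p - 1) := by
      have := Nat.lt_two_pow_self (n := p - 1)
      omega
    exact_mod_cast this
  have h1 := Real.log_le_log (by positivity) h
  rwa [Real.log_pow, Nat.cast_sub hp, Nat.cast_one] at h1

lemma log_natCast_add_one_le {n : ℕ} (hn : 2 ≤ n) :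
    Real.log (n + 1) ≤ 1 / 2 + Real.log n := by
  have hn' : (2 : ℝ) ≤ n := by exact_mod_cast hn
  have h1 : Real.log (n + 1) ≤ Real.log (3 / 2 * n) :=
    Real.log_le_log (by positivity) (by linarith)
  rw [Real.log_mul (by norm_num) (by positivity)] at h1
  have h2 := Real.log_le_sub_one_of_pos (x := 3 / 2) (by norm_num)
  linarith

/-- Once `log (n + 1)` and `log p` are bounded linearly, `-log n` carries the positive coefficient
`72/25 p⁴ - 2p - 2p/11`, so `log n` may be lowered to `log 2`; what remains is at most `(1/2) log 2
< p`. -/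
lemma union_bound_exponent_lt {n p : ℕ} (hn : 2 ≤ n) (hp : 1 ≤ p) :
    2 * p * Real.log (n + 1) + Real.log 2 - 72 / 25 * (p : ℝ) ^ 4 * Real.log n <
      2 * p * (1 - Real.log p) - 2 * p / 11 * Real.log n := by
  have hp' : (1 : ℝ) ≤ p := by exact_mod_cast hp
  have hn' : (2 : ℝ) ≤ n := by exact_mod_cast hn
  have hl : Real.log 2 ≤ Real.log n := Real.log_le_log (by norm_num) hn'
  have hl2 : 0 < Real.log 2 := Real.log_pos (by norm_num)
  have hl2' : Real.log 2 < 1 := by linarith [Real.log_two_lt_d9]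
  have hp2 : (p : ℝ) ≤ p ^ 2 := by nlinarith
  have hp4 : (p : ℝ) ^ 2 ≤ p ^ 4 := pow_le_pow_right₀ hp' (by norm_num)
  have h1 : 2 * p * Real.log (n + 1) ≤ 2 * p * (1 / 2 + Real.log n) := by
    gcongr; exact log_natCast_add_one_le hn
  have h2 : 2 * p * Real.log p ≤ 2 * p * ((p - 1) * Real.log 2) := by
    gcongr; exact log_natCast_le hp
  have h3 : (72 / 25 * (p : ℝ) ^ 4 - 2 * p - 2 * p / 11) * Real.log 2 ≤
      (72 / 25 * (p : ℝ) ^ 4 - 2 * p - 2 * p / 11) * Real.log n := by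
    refine mul_le_mul_of_nonneg_left hl ?_
    linarith
  have h4 : (1 + 2 * p / 11 + 2 * (p : ℝ) ^ 2 - 72 / 25 * (p : ℝ) ^ 4) * Real.log 2 ≤
      1 / 2 * Real.log 2 := by
    refine mul_le_mul_of_nonneg_right ?_ hl2.le
    linarith
  linarith

/-- The union bound over all Gram matrix entries. -/
lemma union_bound_lt {n p s K : ℕ} (hn : 2 ≤ n) (hp : 1 ≤ p) (hs : 1 ≤ s)
    (hK : 144 * (p : ℝ) ^ 6 * 9 ^ p * (s : ℝ) ^ 2 * Real.log n / n ≤ K) (hK0 : 0 < K) :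
    (((n : ℝ) + 1) ^ p) ^ 2 * (2 * Real.exp (-(n * K * (1 / (5 / 2 * s))) ^ 2 /
        (2 * (n * K * (2 * p * 3 ^ p) ^ 2)))) <
      (Real.exp 1 / p + Real.exp 1 / (2 * (p : ℝ) ^ 2)) ^ (2 * p)
        * (n : ℝ) ^ (-(2 * (p : ℝ) / 11)) := by
  have hp' : (0 : ℝ) < p := by exact_mod_cast hp
  have hs' : (0 : ℝ) < s := by exact_mod_cast hs
  have hn' : (0 : ℝ) < n := by positivity
  have hK' : (0 : ℝ) < K := by exact_mod_cast hK0
  have e9 : ((3 : ℝ) ^ p) ^ 2 = 9 ^ p := by rw [← pow_mul, mul_comm, pow_mul]; norm_num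
  -- The exponent equals `-nK / (50 p² 9^p s²)`, and `144 / 50 = 72 / 25`.
  have hexp : -(n * K * (1 / (5 / 2 * (s : ℝ)))) ^ 2 / (2 * (n * K * (2 * p * 3 ^ p) ^ 2)) ≤
      -(72 / 25 * (p : ℝ) ^ 4 * Real.log n) := by
    rw [div_le_iff₀ hn'] at hK
    have e1 : -(n * K * (1 / (5 / 2 * (s : ℝ)))) ^ 2 / (2 * (n * K * (2 * p * 3 ^ p) ^ 2)) =
        -((K * n) / (50 * (p : ℝ) ^ 2 * 9 ^ p * (s : ℝ) ^ 2)) := by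
      rw [mul_pow (2 * (p : ℝ)), e9]
      field_simp
      ring
    rw [e1, neg_le_neg_iff, le_div_iff₀ (by positivity)]
    refine le_trans (le_of_eq ?_) hK
    ring
  have hlhs : (((n : ℝ) + 1) ^ p) ^ 2 * (2 * Real.exp (-(n * K * (1 / (5 / 2 * s))) ^ 2 /
      (2 * (n * K * (2 * p * 3 ^ p) ^ 2)))) ≤
      Real.exp (2 * p * Real.log (n + 1) + Real.log 2 - 72 / 25 * (p : ℝ) ^ 4 * Real.log n) := by
    have e2 : (((n : ℝ) + 1) ^ p) ^ 2 = Real.exp (2 * p * Real.log (n + 1)) := by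
      rw [← pow_mul, ← Real.exp_log (show (0 : ℝ) < ((n : ℝ) + 1) ^ (p * 2) by positivity),
        Real.log_pow]
      push_cast
      ring_nf
    rw [sub_eq_add_neg, Real.exp_add, Real.exp_add, Real.exp_log (by norm_num), e2, mul_assoc (Real.exp _) 2]
    gcongr
  refine hlhs.trans_lt ((Real.exp_lt_exp.2 (union_bound_exponent_lt hn hp)).trans_le ?_)
  -- The bound already holds with `(e/p)^(2p)`; the summand `e/(2p²)` is slack.
  have e3 : Real.exp (2 * p * (1 - Real.log p) - 2 * p / 11 * Real.log n) =
      (Real.exp 1 / p) ^ (2 * p) * (n : ℝ) ^ (-(2 * (p : ℝ) / 11)) := by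
    have h : Real.exp 1 / p = Real.exp (1 - Real.log p) := by
      rw [Real.exp_sub, Real.exp_log hp']
    rw [h, ← Real.exp_nat_mul, Real.rpow_def_of_pos hn', ← Real.exp_add]
    push_cast
    ring_nf
  rw [e3]
  gcongr
  exact le_add_of_nonneg_right (by positivity)

end Estimate

/-! ### Feasibility of `c` and the high-probability event. -/

section Assembly

open MeasureTheory ProbabilityTheory

lemma mulVec_dictionary {n p K : ℕ} [NeZero n] {f : (Fin n → ℝ) → (Fin n → ℝ)}
    {c : MultiIndex n p → ℝ} (hf : IsCyclic f) (hc : IsLegendreCoeff f c)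
    (y : Fin K → Fin n → ℝ) (r : Fin K × Fin n) :
    (dictionary p y).mulVec c r = f (y r.1) r.2 := by
  rw [hf 0 r.2, sub_zero, hc]
  exact Finset.sum_congr rfl fun α _ => mul_comm _ _

/-- The true coefficient vector is feasible for the basis pursuit problem. -/
lemma l2Norm_mulVec_dictionary_sub_le {n p K : ℕ} [NeZero n] {f : (Fin n → ℝ) → (Fin n → ℝ)}
    {c : MultiIndex n p → ℝ} (hf : IsCyclic f) (hc : IsLegendreCoeff f c)
    {t₀ t₁ : ℝ} (ht : t₀ < t₁) {u : Fin K → ℝ → Fin n → ℝ}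
    (hu : ∀ k, IsTrajectory f t₀ t₁ (u k)) {w : Fin K → Fin n → ℝ} {η : ℝ}
    (hη : Real.sqrt (1 / (K : ℝ) *
      ∑ k, l2Norm (w k - derivWithin (u k) (Set.Icc t₀ t₁) t₀) ^ 2) ≤ η) :
    l2Norm ((dictionary p fun k => u k t₀).mulVec c - fun r => w r.1 r.2) ≤ Real.sqrt K * η := by
  have hmem : t₀ ∈ Set.Icc t₀ t₁ := Set.left_mem_Icc.2 ht.le
  have hderiv : ∀ k, derivWithin (u k) (Set.Icc t₀ t₁) t₀ = f (u k t₀) := fun k =>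
    (hu k t₀ hmem).derivWithin (uniqueDiffOn_Icc ht t₀ hmem)
  have hsq : ∑ r, ((dictionary p fun k => u k t₀).mulVec c - fun r : Fin K × Fin n => w r.1 r.2) r ^ 2 =
      ∑ k, l2Norm (w k - derivWithin (u k) (Set.Icc t₀ t₁) t₀) ^ 2 := by
    rw [Fintype.sum_prod_type]
    refine Finset.sum_congr rfl fun k _ => ?_
    rw [sq_l2Norm]
    refine Finset.sum_congr rfl fun i _ => ?_
    rw [hderiv, Pi.sub_apply, Pi.sub_apply, mulVec_dictionary hf hc]
    ring
  rw [l2Norm, hsq]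
  refine le_trans ?_ (mul_le_mul_of_nonneg_left hη (Real.sqrt_nonneg _))
  rw [← Real.sqrt_mul (Nat.cast_nonneg K)]
  refine Real.sqrt_le_sqrt ?_
  -- For `K = 0`, possible when `s = 0`, the sum is empty and the convention `1 / 0 = 0` is
  -- harmless.
  obtain rfl | hK := Nat.eq_zero_or_pos K
  · simp
  · have : (K : ℝ) ≠ 0 := by positivity
    rw [← mul_assoc, mul_one_div_cancel this, one_mul]

lemma sum_dictionary_mul {n p K : ℕ} {y : Fin K → Fin n → ℝ}
    (hy : ∀ k, y k ∈ Set.Icc (-1 : Fin n → ℝ) 1) (α β : MultiIndex n p) :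
    ∑ r, dictionary p y r α * dictionary p y r β = ∑ k, shiftCorrelation α β (clamp (y k)) := by
  rw [Fintype.sum_prod_type]
  refine Finset.sum_congr rfl fun k _ => ?_
  rw [clamp_eq_self (hy k)]
  rfl

/-- With high probability the samples lie in the box and the sampling matrix is incoherent. -/
theorem exists_event_incoherent {n p s K : ℕ} [NeZero n] (hn : 2 ≤ n) (hp : 1 ≤ p) (hs : 1 ≤ s)
    (hK : 144 * (p : ℝ) ^ 6 * 9 ^ p * (s : ℝ) ^ 2 * Real.log n / n ≤ K) (hK0 : 0 < K)
    {Ω : Type*} [MeasurableSpace Ω] {P : Measure Ω} [IsProbabilityMeasure P]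
    {y : Fin K → Ω → Fin n → ℝ}
    (hy : ∀ k, pdf.IsUniform (y k) (Set.Icc (-1 : Fin n → ℝ) 1) P volume)
    (hind : iIndepFun y P) {Q : Ω → Prop} (hQ : ∀ᵐ ω ∂P, Q ω) :
    ∃ E : Set Ω, MeasurableSet E ∧
      1 - (Real.exp 1 / p + Real.exp 1 / (2 * (p : ℝ) ^ 2)) ^ (2 * p)
        * (n : ℝ) ^ (-(2 * (p : ℝ) / 11)) < P.real E ∧
      ∀ ω ∈ E, Q ω ∧ ∀ α β : MultiIndex n p,
        |∑ r, dictionary p (fun k => y k ω) r α * dictionary p (fun k => y k ω) r β -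
          (n * K : ℝ) * (if α = β then 1 else 0)| ≤ (n * K : ℝ) * (1 / (5 / 2 * s)) := by
  set ε : ℝ := (n * K : ℝ) * (1 / (5 / 2 * s)) with hε
  have hε0 : 0 ≤ ε := by positivity
  have hbox : ∀ᵐ ω ∂P, ∀ k, y k ω ∈ Set.Icc (-1 : Fin n → ℝ) 1 := by
    rw [ae_all_iff]
    intro k
    have hmeas := (hy k).aemeasurable (volume_box_ne n).1 (volume_box_ne n).2
    refine ae_of_ae_map hmeas ?_
    rw [show P.map (y k) = _ from hy k]
    exact ae_cond_mem measurableSet_Icc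
  set dev : MultiIndex n p × MultiIndex n p → Set Ω := fun a =>
    {ω | ε ≤ |∑ k, shiftCorrelation a.1 a.2 (clamp (y k ω)) -
      (n * K : ℝ) * if a.1 = a.2 then 1 else 0|} with hdev
  -- The almost sure requirements cost no probability, so they join the bad set for free.
  set null : Set Ω := {ω | ¬ (Q ω ∧ ∀ k, y k ω ∈ Set.Icc (-1 : Fin n → ℝ) 1)} with hnull
  have hnull0 : P.real null = 0 := by
    rw [measureReal_def, show P null = 0 from ae_iff.1 (hQ.and hbox), ENNReal.toReal_zero]
  set b : ℝ := 2 * Real.exp (-ε ^ 2 / (2 * (n * K * (2 * p * 3 ^ p) ^ 2))) with hb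
  have hdevle : P.real (⋃ a, dev a) ≤ (((n : ℝ) + 1) ^ p) ^ 2 * b := by
    have hcard : (Fintype.card (MultiIndex n p) : ℝ) ≤ ((n : ℝ) + 1) ^ p := by
      exact_mod_cast card_multiIndex_le n p
    calc P.real (⋃ a, dev a) ≤ ∑ a, P.real (dev a) := measureReal_iUnion_fintype_le _
      _ ≤ ∑ _a : MultiIndex n p × MultiIndex n p, b := Finset.sum_le_sum fun a _ =>
          measureReal_shiftCorrelation_ge_le hy hind a.1 a.2 hε0
      _ = (Fintype.card (MultiIndex n p) : ℝ) ^ 2 * b := by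
          rw [Finset.sum_const, Finset.card_univ, Fintype.card_prod, nsmul_eq_mul]
          push_cast
          ring
      _ ≤ _ := by gcongr
  have hbad : P.real (null ∪ ⋃ a, dev a) <
      (Real.exp 1 / p + Real.exp 1 / (2 * (p : ℝ) ^ 2)) ^ (2 * p)
        * (n : ℝ) ^ (-(2 * (p : ℝ) / 11)) := by
    have h1 := measureReal_union_le (μ := P) null (⋃ a, dev a)
    have h2 := union_bound_lt hn hp hs hK hK0
    linarith
  obtain ⟨E, hE, hPE, hgood⟩ := exists_measurableSet_of_measureReal_lt hbad
  refine ⟨E, hE, hPE, fun ω hω => ?_⟩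
  have h := hgood ω hω
  rw [Set.mem_union, not_or] at h
  have h1 : Q ω ∧ ∀ k, y k ω ∈ Set.Icc (-1 : Fin n → ℝ) 1 := not_not.1 h.1
  refine ⟨h1.1, fun α β => ?_⟩
  rw [sum_dictionary_mul h1.2]
  by_contra hcon
  exact h.2 (Set.mem_iUnion.2 ⟨(α, β), (not_le.1 hcon).le⟩)

end Assembly

end CyclicRecovery

/-! ### The recovery theorem. -/

theorem proposition3p5 :
    ∃ d : ℝ, 0 < d ∧
      ∀ (n p s K : ℕ) [NeZero n], 2 ≤ n → 1 ≤ p →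
      144 * (p : ℝ) ^ 6 * 9 ^ p * (s : ℝ) ^ 2 * Real.log n / n ≤ K →
      ∀ (f : (Fin n → ℝ) → (Fin n → ℝ)) (c : CyclicRecovery.MultiIndex n p → ℝ),
      CyclicRecovery.IsCyclic f →
      CyclicRecovery.IsLegendreCoeff f c →
      (CyclicRecovery.supp c).card ≤ s →
      ∀ (Ω : Type*) [MeasurableSpace Ω] (P : MeasureTheory.Measure Ω)
        [MeasureTheory.IsProbabilityMeasure P]
        (t₀ t₁ : ℝ) (u : Fin K → Ω → ℝ → (Fin n → ℝ)),
      t₀ < t₁ →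
      (∀ᵐ ω ∂P, ∀ k, CyclicRecovery.IsTrajectory f t₀ t₁ (u k ω)) →
      (∀ k, MeasureTheory.pdf.IsUniform (fun ω => u k ω t₀)
        (Set.Icc (-1 : Fin n → ℝ) 1) P MeasureTheory.volume) →
      ProbabilityTheory.iIndepFun (fun k ω => u k ω t₀) P →
      ∃ E : Set Ω, MeasurableSet E ∧
        1 - (Real.exp 1 / p + Real.exp 1 / (2 * (p : ℝ) ^ 2)) ^ (2 * p)
            * (n : ℝ) ^ (-(2 * (p : ℝ) / 11)) < P.real E ∧
        ∀ ω ∈ E, ∀ (w : Fin K → Fin n → ℝ) (η σ : ℝ) (z : CyclicRecovery.MultiIndex n p → ℝ),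
          Real.sqrt (1 / (K : ℝ) *
            ∑ k, CyclicRecovery.l2Norm
              (w k - derivWithin (u k ω) (Set.Icc t₀ t₁) t₀) ^ 2) ≤ η →
          σ = Real.sqrt K * η →
          CyclicRecovery.IsBPMinimizer
            (CyclicRecovery.dictionary p (fun k => u k ω t₀)) (fun r => w r.1 r.2) σ z →
          CyclicRecovery.l1Norm (c - z) ≤ d * s * σ ∧
          ((∀ j ∈ CyclicRecovery.supp c, σ < |c j| / (2 * d * s)) →
            ∀ T : Finset (CyclicRecovery.MultiIndex n p),
              CyclicRecovery.IsLargestSet z (CyclicRecovery.supp c).card T →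
              T = CyclicRecovery.supp c) := by
  refine ⟨24, by norm_num, ?_⟩
  intro n p s K _ hn hp hK f c hf hc hcard Ω _ P _ t₀ t₁ u ht hu hunif hind
  open CyclicRecovery in
  have hsupp : ∀ j ∉ supp c, c j = 0 := fun j hj => by simpa [supp] using hj
  have hn' : (0 : ℝ) < n := by positivity
  open CyclicRecovery in
  suffices h : ∃ E : Set Ω, MeasurableSet E ∧
      1 - (Real.exp 1 / p + Real.exp 1 / (2 * (p : ℝ) ^ 2)) ^ (2 * p)
          * (n : ℝ) ^ (-(2 * (p : ℝ) / 11)) < P.real E ∧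
      ∀ ω ∈ E, ∀ (w : Fin K → Fin n → ℝ) (η σ : ℝ) (z : MultiIndex n p → ℝ),
        Real.sqrt (1 / (K : ℝ) *
          ∑ k, l2Norm (w k - derivWithin (u k ω) (Set.Icc t₀ t₁) t₀) ^ 2) ≤ η →
        σ = Real.sqrt K * η →
        IsBPMinimizer (dictionary p (fun k => u k ω t₀)) (fun r => w r.1 r.2) σ z →
        l1Norm (c - z) ≤ 24 * s * σ by
    obtain ⟨E, hE, hPE, hgood⟩ := h
    refine ⟨E, hE, hPE, fun ω hω w η σ z hη hσ hz => ?_⟩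
    have hl1 := hgood ω hω w η σ z hη hσ hz
    refine ⟨hl1, fun hsmall T hT => eq_supp_of_isLargestSet hl1 (fun j hj => ?_) hT⟩
    -- A support element forces `s > 0`, so the quotient in `hsmall` is not a division by zero.
    have hs : (0 : ℝ) < s := by
      exact_mod_cast (Finset.card_pos.2 ⟨j, hj⟩).trans_le hcard
    have h := hsmall j hj
    rw [lt_div_iff₀ (by positivity)] at h
    linarith
  -- For `s = 0` there may be no samples, so incoherence is unavailable; but `c = 0` is feasible,
  -- and minimality forces `‖z‖₁ ≤ 0`.
  obtain rfl | hs := Nat.eq_zero_or_pos s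
  · have hc0 : c = 0 := by
      funext j
      refine hsupp j ?_
      rw [Finset.card_eq_zero.1 (Nat.le_zero.1 hcard)]
      exact Finset.notMem_empty j
    have hpos : (0 : ℝ) < (Real.exp 1 / p + Real.exp 1 / (2 * (p : ℝ) ^ 2)) ^ (2 * p)
        * (n : ℝ) ^ (-(2 * (p : ℝ) / 11)) := by
      have hp' : (0 : ℝ) < p := by exact_mod_cast hp
      positivity
    obtain ⟨E, hE, hPE, hgood⟩ :=
      CyclicRecovery.exists_measurableSet_of_measureReal_lt (P := P)
        (bad := {ω | ¬ ∀ k, CyclicRecovery.IsTrajectory f t₀ t₁ (u k ω)})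
        (lt_of_eq_of_lt (by
          rw [MeasureTheory.measureReal_def, MeasureTheory.ae_iff.1 hu, ENNReal.toReal_zero]) hpos)
    refine ⟨E, hE, hPE, fun ω hω w η σ z hη hσ hz => ?_⟩
    have hfeas := CyclicRecovery.l2Norm_mulVec_dictionary_sub_le hf hc ht
      (not_not.1 (hgood ω hω)) hη
    rw [← hσ] at hfeas
    have h := hz.2 c hfeas
    subst hc0
    simpa [CyclicRecovery.l1Norm] using h
  · have hlog : 0 < Real.log n := Real.log_pos (by exact_mod_cast hn)
    have hK0 : 0 < K := by
      have : (0 : ℝ) < K := lt_of_lt_of_le (by positivity) hK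
      exact_mod_cast this
    obtain ⟨E, hE, hPE, hgood⟩ :=
      CyclicRecovery.exists_event_incoherent hn hp hs hK hK0 hunif hind hu
    refine ⟨E, hE, hPE, fun ω hω w η σ z hη hσ hz => ?_⟩
    obtain ⟨htraj, hgram⟩ := hgood ω hω
    have hfeas := CyclicRecovery.l2Norm_mulVec_dictionary_sub_le hf hc ht htraj hη
    rw [← hσ] at hfeas
    have hM : (1 : ℝ) ≤ n * K := by
      have : 1 ≤ n * K := Nat.mul_pos (by omega) hK0
      exact_mod_cast this
    exact CyclicRecovery.l1Norm_sub_le_of_gram hM hs hgram hcard hsupp hfeas hz
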